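/- Let $k\ge 0$ be an integer and let $\mathbb{S}^{2k+1}\subset\mathbb{R}^{2k+2}$ be the unit sphere with its round metric, Levi-Civita connection $\nabla$ and volume measure $\nu$. A Hopf flow is a vector field $H(x)=Jx$ on $\mathbb{S}^{2k+1}$, where $J$ is an orthogonal linear map of $\mathbb{R}^{2k+2}$ with $J^2=-\mathrm{Id}$. Let $U\subset\mathbb{S}^{2k+1}$ be open and let $K\subset U$ be a compact connected smooth $(2k+1)$-dimensional submanifold with (possibly empty) boundary of $\mathbb{S}^{2k+1}$. For a smooth unit tangent vector field $X$ defined on a neighbourhood of $K$, its energy on $K$ is $$\mathcal{E}(X)=\frac{2k+1}{2}\,\mathrm{vol}(K)+\frac12\int_K\|\nabla X\|^2\,d\nu ,$$ where $\|\nabla X\|^2=\sum_a\|\nabla_{e_a}X\|^2$ for an orthonormal basis $(e_a)$ of the tangent space. Let $v$ be a smooth unit tangent vector field on $U$ that is solenoidal ($\operatorname{div} v=\operatorname{tr}\nabla v=0$ on $U$), and let $H$ be a Hopf flow such that $v=H$ on $\partial K$. Then $$\mathcal{E}(v)\ \ge\ \left(\frac{2k+1}{2}+k\right)\mathrm{vol}(K)\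 =\ \mathcal{E}(H).$$ -/

import Mathlib

open scoped Manifold ContDiff RealInnerProductSpace

noncomputable section

namespace HopfEnergy

/-- The Euclidean space `ℝ^{2k+2}`. -/
abbrev Ambient (k : ℕ) : Type := EuclideanSpace ℝ (Fin (2 * k + 1 + 1))

/-- The unit sphere `S^{2k+1}`, with the smooth structure of Mathlib. -/
abbrev Sph (k : ℕ) : Type := Metric.sphere (0 : Ambient k) 1

/-- The tangent space `T_x S^{2k+1}`, as the hyperplane `x^⊥` of `ℝ^{2k+2}`. -/
abbrev Tan {k : ℕ} (x : Sph k) : Submodule ℝ (Ambient k) := (Submodule.span ℝ {(x : Ambient k)})ᗮ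

/-- The Riemannian volume measure of `S^{2k+1}`. -/
def sphVol (k : ℕ) : MeasureTheory.Measure (Sph k) :=
  (MeasureTheory.volume : MeasureTheory.Measure (Ambient k)).toSphere

/-- The volume of a subset of `S^{2k+1}`. -/
def vol {k : ℕ} (K : Set (Sph k)) : ℝ := (sphVol k).real K

/-- The extension of `v` to `ℝ^{2k+2} ∖ {0}` that is constant on rays (and `0` at the origin). -/
def radialExt {k : ℕ} (v : Sph k → Ambient k) (y : Ambient k) : Ambient k :=
  if h : y = 0 then 0
  else v ⟨NormedSpace.normalize y, by simp [NormedSpace.norm_normalize h]⟩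

/-- The Levi-Civita covariant derivative `X ↦ ∇_X v` at `x`, an endomorphism of `T_x S^{2k+1}`: the
orthogonal projection to the tangent space of the derivative of `v` in the direction `X`. The
derivative of `v` along a tangent direction is that of any extension of `v`. -/
def covDeriv {k : ℕ} (v : Sph k → Ambient k) (x : Sph k) : Tan x →L[ℝ] Tan x :=
  (Tan x).orthogonalProjectionOnto ∘L fderiv ℝ (radialExt v) (x : Ambient k) ∘L (Tan x).subtypeL

/-- The divergence of `v` at `x`, the trace of `∇ v`. -/
def divergence {k : ℕ} (v : Sph k → Ambient k) (x : Sph k) : ℝ :=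
  LinearMap.trace ℝ (Tan x) (covDeriv v x).toLinearMap

/-- The squared norm `‖∇ v‖² = ∑ₐ ‖∇_{eₐ} v‖²` at `x`, over an orthonormal basis of the tangent
space (the value does not depend on the basis). -/
def normSqCovDeriv {k : ℕ} (v : Sph k → Ambient k) (x : Sph k) : ℝ :=
  ∑ a, ‖covDeriv v x (stdOrthonormalBasis ℝ (Tan x) a)‖ ^ 2

/-- The energy on `K` of a unit vector field. -/
def energy {k : ℕ} (K : Set (Sph k)) (v : Sph k → Ambient k) : ℝ :=
  (2 * (k : ℝ) + 1) / 2 * vol K + 1 / 2 * ∫ x in K, normSqCovDeriv v x ∂(sphVol k)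

/-- `v` restricts to a smooth unit tangent vector field on `U`. -/
structure IsUnitVectorFieldOn {k : ℕ} (U : Set (Sph k)) (v : Sph k → Ambient k) : Prop where
  smooth : ContMDiffOn (𝓡 (2 * k + 1)) 𝓘(ℝ, Ambient k) ∞ v U
  tangent : ∀ x ∈ U, v x ∈ Tan x
  unit : ∀ x ∈ U, ‖v x‖ = 1

/-- `v` is divergence free on `U`. -/
def IsSolenoidalOn {k : ℕ} (U : Set (Sph k)) (v : Sph k → Ambient k) : Prop :=
  ∀ x ∈ U, divergence v x = 0

/-- A Hopf flow: `H x = J x` for an orthogonal complex structure `J` of `ℝ^{2k+2}`. -/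
def IsHopfFlow {k : ℕ} (H : Sph k → Ambient k) : Prop :=
  ∃ J : Ambient k ≃ₗᵢ[ℝ] Ambient k, (∀ y, J (J y) = -y) ∧ ∀ x : Sph k, H x = J x

/-- A smooth chart of the sphere in which `K` is the half-space `{y | 0 ≤ y₀}`. -/
def IsAdaptedChart {k : ℕ} (K : Set (Sph k))
    (e : OpenPartialHomeomorph (Sph k) (EuclideanSpace ℝ (Fin (2 * k + 1)))) : Prop :=
  e ∈ IsManifold.maximalAtlas (𝓡 (2 * k + 1)) ∞ (Sph k) ∧
    ∀ x ∈ e.source, x ∈ K ↔ 0 ≤ e x 0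

/-- `K` is a smooth `(2k+1)`-dimensional submanifold with (possibly empty) boundary of the sphere:
each of its points lies in an adapted chart. Interior points are those with positive zeroth
coordinate. -/
def IsSubmanifoldWithBoundary {k : ℕ} (K : Set (Sph k)) : Prop :=
  ∀ x ∈ K, ∃ e, IsAdaptedChart K e ∧ x ∈ e.source

/-- The manifold boundary `∂K`: the points that an adapted chart sends to the boundary
of the half-space. -/
def bdry {k : ℕ} (K : Set (Sph k)) : Set (Sph k) :=
  {x | ∃ e, IsAdaptedChart K e ∧ x ∈ e.source ∧ e x 0 = 0}

end HopfEnergy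

end

/-! For a linear map A put q(A) = (tr A)² − tr(A²), the form `traceForm`. If div v = 0, then q(∇v) =
−tr((∇v)²) ≤ ‖∇v‖², because ‖A + Aᵀ‖² ≥ 0. The inequality therefore follows from ∫_K q(∇v) = 2k
vol(K). A Hopf flow is a Killing field with q(∇H) = ‖∇H‖² = 2k at every point, which gives its
energy.

On the whole sphere, smooth tangent fields satisfy the Bochner formula ∫ q(∇V) = ∫ Ric(V, V) = 2k ∫
‖V‖² (`integral_traceForm_extDeriv`). It is derived from flat space: q(DF) is a sum of 2×2 Jacobian
minors, so its integral vanishes when F is C² with compact support. Take for F a radial cutoff times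
the extension of V that is constant on rays. In polar coordinates q(DF) splits into a multiple of
q(∇V) and a multiple of ‖V‖², and a one-dimensional integration by parts in the radius produces the
factor 2k.

To localise to K (`setIntegral_traceForm_extDeriv`), v is continued by H outside K. The result need
not be smooth across ∂K, so v − H is truncated to zero where its norm is at most 1/m. The new fields
are smooth on the whole sphere, with derivatives bounded uniformly in m. Off K the integrand q(∇H) −
2k‖H‖² is zero. On K the integrands converge almost everywhere to q(∇v) − 2k, since ∇v = ∇H almost
everywhere on {v = H}. Dominated convergence then gives the claim, with no boundary integral. -/

noncomputable section

namespace HopfEnergy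

open Filter Topology MeasureTheory

variable {k : ℕ}

/-! ### Extensions constant on rays and their derivatives -/

lemma Sph.ne_zero (x : Sph k) : (x : Ambient k) ≠ 0 := ne_zero_of_mem_unit_sphere x

/-- The direction `y / ‖y‖` of a nonzero vector, as a point of the sphere. -/
def direction (y : Ambient k) : Sph k :=
  -- An arbitrary point, so that the map is total.
  if h : y = 0 then ⟨EuclideanSpace.single 0 1, by simp⟩
  else ⟨NormedSpace.normalize y, by simp [NormedSpace.norm_normalize h]⟩

lemma coe_direction {y : Ambient k} (hy : y ≠ 0) : (direction y : Ambient k) = ‖y‖⁻¹ • y := by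
  simp [direction, hy, NormedSpace.normalize]

lemma direction_smul (x : Sph k) {r : ℝ} (hr : 0 < r) : direction (r • (x : Ambient k)) = x := by
  have h : r • (x : Ambient k) ≠ 0 := smul_ne_zero hr.ne' x.ne_zero
  ext1
  rw [coe_direction h, norm_smul, norm_eq_of_mem_sphere, smul_smul]
  simp [abs_of_pos hr, hr.ne']

lemma direction_coe (x : Sph k) : direction (x : Ambient k) = x := by
  simpa using direction_smul x one_pos

lemma radialExt_of_ne_zero (v : Sph k → Ambient k) {y : Ambient k} (hy : y ≠ 0) :
    radialExt v y = v (direction y) := by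
  simp [radialExt, direction, hy]

lemma radialExt_coe (v : Sph k → Ambient k) (x : Sph k) : radialExt v x = v x := by
  rw [radialExt_of_ne_zero v x.ne_zero, direction_coe]

lemma radialExt_smul (v : Sph k → Ambient k) {r : ℝ} (hr : 0 < r) (y : Ambient k) :
    radialExt v (r • y) = radialExt v y := by
  by_cases hy : y = 0
  · simp [hy]
  · have h : r • y ≠ 0 := smul_ne_zero hr.ne' hy
    rw [radialExt_of_ne_zero v h, radialExt_of_ne_zero v hy]
    congr 1
    ext1
    rw [coe_direction h, coe_direction hy, norm_smul, smul_smul]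
    congr 1
    simp [abs_of_pos hr]
    field_simp

lemma contMDiffAt_direction {y : Ambient k} (hy : y ≠ 0) :
    ContMDiffAt 𝓘(ℝ, Ambient k) (𝓡 (2 * k + 1)) ∞ (direction (k := k)) y := by
  let O : TopologicalSpace.Opens (Ambient k) := ⟨{0}ᶜ, isOpen_compl_singleton⟩
  have hsm : ContMDiff 𝓘(ℝ, Ambient k) 𝓘(ℝ, Ambient k) ∞
      (fun z : O => ‖(z : Ambient k)‖⁻¹ • (z : Ambient k)) := by
    intro z
    have hz : (z : Ambient k) ≠ 0 := z.2
    have : ContDiffAt ℝ ∞ (fun z : Ambient k => ‖z‖⁻¹ • z) z :=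
      ((contDiffAt_norm ℝ hz).inv (norm_ne_zero_iff.2 hz)).smul contDiffAt_id
    exact contMDiffAt_subtype_iff.2 this.contMDiffAt
  have hmem : ∀ z : O, ‖(z : Ambient k)‖⁻¹ • (z : Ambient k) ∈ Metric.sphere (0 : Ambient k) 1 := by
    intro z
    have hz : (z : Ambient k) ≠ 0 := z.2
    simp [norm_smul, hz]
  have : Fact (Module.finrank ℝ (Ambient k) = 2 * k + 1 + 1) := ⟨finrank_euclideanSpace_fin⟩
  have h := hsm.codRestrict_sphere (n := 2 * k + 1) hmem
  have heq : (fun z : O => direction (z : Ambient k)) = Set.codRestrict _ _ hmem := by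
    funext z
    ext1
    exact coe_direction z.2
  have h' : ContMDiffAt 𝓘(ℝ, Ambient k) (𝓡 (2 * k + 1)) ∞
      (fun z : O => direction (z : Ambient k)) ⟨y, hy⟩ := by
    rw [heq]; exact h _
  exact contMDiffAt_subtype_iff.1 h'

lemma continuousAt_direction {y : Ambient k} (hy : y ≠ 0) : ContinuousAt (direction (k := k)) y :=
  (contMDiffAt_direction hy).continuousAt

lemma radialExt_eventuallyEq (v : Sph k → Ambient k) {y : Ambient k} (hy : y ≠ 0) :
    radialExt v =ᶠ[𝓝 y] fun z => v (direction z) := by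
  filter_upwards [isOpen_compl_singleton.mem_nhds hy] with z hz
  exact radialExt_of_ne_zero v hz

lemma contDiffAt_radialExt {v : Sph k → Ambient k} {y : Ambient k} (hy : y ≠ 0)
    (hv : ContMDiffAt (𝓡 (2 * k + 1)) 𝓘(ℝ, Ambient k) ∞ v (direction y)) :
    ContDiffAt ℝ ∞ (radialExt v) y := by
  have h := ContMDiffAt.comp y hv (contMDiffAt_direction hy)
  exact (contMDiffAt_iff_contDiffAt.1 h).congr_of_eventuallyEq (radialExt_eventuallyEq v hy)

lemma radialExt_congr {v w : Sph k → Ambient k} {y : Ambient k} (hy : y ≠ 0)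
    (h : v =ᶠ[𝓝 (direction y)] w) : radialExt v =ᶠ[𝓝 y] radialExt w := by
  filter_upwards [radialExt_eventuallyEq v hy, radialExt_eventuallyEq w hy,
    (continuousAt_direction hy).eventually h] with z h1 h2 h3
  rw [h1, h2, h3]

/-- The derivative at `x` of the extension of `v` that is constant on rays. -/
def extDeriv (v : Sph k → Ambient k) (x : Sph k) : Ambient k →L[ℝ] Ambient k :=
  fderiv ℝ (radialExt v) x

/-- A function homogeneous of degree 0 has a derivative homogeneous of degree −1. -/
lemma fderiv_radialExt_smul (v : Sph k → Ambient k) (x : Sph k) {r : ℝ} (hr : 0 < r) :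
    fderiv ℝ (radialExt v) (r • (x : Ambient k)) = r⁻¹ • extDeriv v x := by
  have h := fderiv_comp_smul (𝕜 := ℝ) (f := radialExt v) (x := (x : Ambient k)) r
  have h2 : (fun y => radialExt v (r • y)) = radialExt v := funext fun y => radialExt_smul v hr y
  rw [h2] at h
  rw [extDeriv, h, smul_smul, inv_mul_cancel₀ hr.ne', one_smul]

lemma extDeriv_self (v : Sph k → Ambient k) (x : Sph k) : extDeriv v x x = 0 := by
  by_cases hd : DifferentiableAt ℝ (radialExt v) (x : Ambient k)
  · have h1 : HasDerivAt (fun t : ℝ => radialExt v ((x : Ambient k) + t • (x : Ambient k)))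
        (extDeriv v x x) 0 := hd.hasFDerivAt.hasLineDerivAt (x : Ambient k)
    have h2 : (fun t : ℝ => radialExt v ((x : Ambient k) + t • (x : Ambient k)))
        =ᶠ[𝓝 0] fun _ => radialExt v x := by
      filter_upwards [lt_mem_nhds (show (-1 : ℝ) < 0 by norm_num)] with t ht
      have : (x : Ambient k) + t • (x : Ambient k) = (1 + t) • (x : Ambient k) := by
        rw [add_smul, one_smul]
      rw [this, radialExt_smul v (by linarith)]
    exact h1.unique ((hasDerivAt_const (0 : ℝ) _).congr_of_eventuallyEq h2)
  · rw [extDeriv, fderiv_zero_of_not_differentiableAt hd]; rfl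

/-- Differentiate ⟪y, v y⟫ = 0. This normal component is the second fundamental form of the sphere,
and the curvature enters the proof here. -/
lemma inner_extDeriv {v : Sph k → Ambient k} {x : Sph k}
    (hd : DifferentiableAt ℝ (radialExt v) (x : Ambient k))
    (ht : ∀ᶠ z : Sph k in 𝓝 x, ⟪(z : Ambient k), v z⟫ = 0) (u : Ambient k) :
    ⟪(x : Ambient k), extDeriv v x u⟫ = -⟪u, v x⟫ := by
  have h0 : (fun y : Ambient k => ⟪y, radialExt v y⟫) =ᶠ[𝓝 (x : Ambient k)] fun _ => 0 := by
    have hc := continuousAt_direction x.ne_zero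
    rw [ContinuousAt, direction_coe] at hc
    filter_upwards [hc.eventually ht, isOpen_compl_singleton.mem_nhds x.ne_zero] with y hy hy0
    rw [radialExt_of_ne_zero v hy0]
    rw [coe_direction hy0, real_inner_smul_left] at hy
    exact (mul_eq_zero.1 hy).resolve_left (inv_ne_zero (norm_ne_zero_iff.2 hy0))
  have h1 := (hasFDerivAt_id (𝕜 := ℝ) (x : Ambient k)).inner ℝ hd.hasFDerivAt
  have h2 := h1.unique ((hasFDerivAt_const (0 : ℝ) (x : Ambient k)).congr_of_eventuallyEq h0)
  have h3 := congrArg (fun A : Ambient k →L[ℝ] ℝ => A u) h2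
  simp [radialExt_coe] at h3
  rw [extDeriv]
  linarith

/-! ### The form (tr A)² − tr(A²) and its integral over flat space -/

/-- The quadratic form `(tr A)² - tr (A²)`. -/
def traceForm (A : Ambient k →L[ℝ] Ambient k) : ℝ :=
  ∑ i, ∑ j, (A (EuclideanSpace.single i 1) i * A (EuclideanSpace.single j 1) j -
    A (EuclideanSpace.single j 1) i * A (EuclideanSpace.single i 1) j)

lemma continuous_traceForm : Continuous (traceForm (k := k)) := by
  unfold traceForm
  fun_prop

lemma trace_eq_sum_coord (A : Ambient k →ₗ[ℝ] Ambient k) :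
    LinearMap.trace ℝ (Ambient k) A = ∑ i, A (EuclideanSpace.single i 1) i := by
  rw [LinearMap.trace_eq_sum_inner A (EuclideanSpace.basisFun _ ℝ)]
  simp [EuclideanSpace.inner_single_left]

lemma traceForm_eq (A : Ambient k →L[ℝ] Ambient k) :
    traceForm A = LinearMap.trace ℝ (Ambient k) A.toLinearMap ^ 2 -
      LinearMap.trace ℝ (Ambient k) (A.toLinearMap ∘ₗ A.toLinearMap) := by
  have hA : ∀ u : Ambient k, A u = ∑ j, u j • A (EuclideanSpace.single j 1) := by
    intro u
    conv_lhs => rw [← (EuclideanSpace.basisFun _ ℝ).sum_repr u]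
    simp
  rw [trace_eq_sum_coord, trace_eq_sum_coord, traceForm, sq, Finset.sum_mul_sum,
    ← Finset.sum_sub_distrib]
  refine Finset.sum_congr rfl fun i _ => ?_
  rw [Finset.sum_sub_distrib]
  congr 1
  simp only [LinearMap.comp_apply, ContinuousLinearMap.coe_coe]
  rw [hA (A _)]
  simp [mul_comm]

lemma traceForm_smul (c : ℝ) (A : Ambient k →L[ℝ] Ambient k) :
    traceForm (c • A) = c ^ 2 * traceForm A := by
  simp only [traceForm, Finset.mul_sum]
  refine Finset.sum_congr rfl fun i _ => Finset.sum_congr rfl fun j _ => ?_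
  simp
  ring

/-- Since l u = 0, the rank-one map l ⊗ u has trace zero and square zero; only the two cross terms
survive, each of trace l (A u). -/
lemma traceForm_add_smulRight (A : Ambient k →L[ℝ] Ambient k) (l : Ambient k →L[ℝ] ℝ)
    (u : Ambient k) (hl : l u = 0) :
    traceForm (A + l.smulRight u) = traceForm A - 2 * l (A u) := by
  rw [traceForm_eq, traceForm_eq]
  have e1 : (A + l.smulRight u).toLinearMap = A.toLinearMap + l.toLinearMap.smulRight u := rfl
  have e2 : (A.toLinearMap + l.toLinearMap.smulRight u) ∘ₗ
      (A.toLinearMap + l.toLinearMap.smulRight u) = A.toLinearMap ∘ₗ A.toLinearMap +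
        (l.toLinearMap ∘ₗ A.toLinearMap).smulRight u + l.toLinearMap.smulRight (A u) := by
    ext z i
    simp [hl]
    ring
  rw [e1, e2]
  simp only [map_add, LinearMap.trace_smulRight]
  simp [hl]
  ring

/-- Moving the derivative off f turns both sides into −∫ f ∂ᵤ∂ᵥ g, by symmetry of the second
derivative. -/
lemma integral_fderiv_mul_fderiv_comm {E : Type*} [NormedAddCommGroup E] [NormedSpace ℝ E]
    [FiniteDimensional ℝ E] [MeasurableSpace E] [BorelSpace E] (μ : Measure E)
    [μ.IsAddHaarMeasure] {f g : E → ℝ} (hf : ContDiff ℝ 2 f) (hg : ContDiff ℝ 2 g)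
    (hfc : HasCompactSupport f) (u v : E) :
    ∫ x, fderiv ℝ f x u * fderiv ℝ g x v ∂μ = ∫ x, fderiv ℝ f x v * fderiv ℝ g x u ∂μ := by
  have hg1 : ContDiff ℝ 1 (fderiv ℝ g) := hg.fderiv_right (by norm_num)
  have hf0 : Continuous (fderiv ℝ f) := hf.continuous_fderiv (by norm_num)
  have hg2 : Continuous (fderiv ℝ (fderiv ℝ g)) := hg1.continuous_fderiv (by norm_num)
  have hsnd : ∀ (a b x : E), fderiv ℝ (fun y => fderiv ℝ g y a) x b
      = fderiv ℝ (fderiv ℝ g) x b a := by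
    intro a b x
    rw [fderiv_clm_apply (hg1.differentiable (by norm_num) x) (differentiableAt_const a)]
    simp
  have key : ∀ a b : E, ∫ x, fderiv ℝ g x a * fderiv ℝ f x b ∂μ
      = -∫ x, fderiv ℝ (fderiv ℝ g) x b a * f x ∂μ := by
    intro a b
    simp_rw [← hsnd]
    refine integral_mul_fderiv_eq_neg_fderiv_mul_of_integrable ?_ ?_ ?_ ?_ ?_
    · simp_rw [hsnd]
      refine Continuous.integrable_of_hasCompactSupport ?_ hfc.mul_left
      exact ((hg2.clm_apply continuous_const).clm_apply continuous_const).mul hf.continuous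
    · refine Continuous.integrable_of_hasCompactSupport ?_ (hfc.fderiv_apply ℝ b).mul_left
      exact (hg1.continuous.clm_apply continuous_const).mul (hf0.clm_apply continuous_const)
    · refine Continuous.integrable_of_hasCompactSupport ?_ hfc.mul_left
      exact (hg1.continuous.clm_apply continuous_const).mul hf.continuous
    · intro x _
      exact (hg1.differentiable (by norm_num) x).clm_apply (differentiableAt_const a)
    · intro x _
      exact hf.differentiable (by norm_num) x
  have hsymm : ∀ x, fderiv ℝ (fderiv ℝ g) x u v = fderiv ℝ (fderiv ℝ g) x v u := fun x =>
    (hg.contDiffAt.isSymmSndFDerivAt (by simp)) u v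
  calc ∫ x, fderiv ℝ f x u * fderiv ℝ g x v ∂μ = ∫ x, fderiv ℝ g x v * fderiv ℝ f x u ∂μ := by
        simp_rw [mul_comm]
    _ = ∫ x, fderiv ℝ g x u * fderiv ℝ f x v ∂μ := by
        rw [key, key]; simp_rw [hsymm]
    _ = ∫ x, fderiv ℝ f x v * fderiv ℝ g x u ∂μ := by simp_rw [mul_comm]

lemma integral_traceForm_fderiv {F : Ambient k → Ambient k} (hF : ContDiff ℝ 2 F)
    (hFc : HasCompactSupport F) : ∫ y, traceForm (fderiv ℝ F y) = 0 := by
  have hF0 : Continuous (fderiv ℝ F) := hF.continuous_fderiv (by norm_num)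
  have hcoord : ∀ i, ContDiff ℝ 2 (fun y => F y i) := fun i => by fun_prop
  have hd : ∀ i y u, fderiv ℝ (fun y => F y i) y u = fderiv ℝ F y u i := by
    intro i y u
    have h := ((EuclideanSpace.proj i : Ambient k →L[ℝ] ℝ).hasFDerivAt).comp y
      (hF.differentiable (by norm_num) y).hasFDerivAt
    exact congrArg (fun A : Ambient k →L[ℝ] ℝ => A u) h.fderiv
  have hcs : ∀ i, HasCompactSupport (fun y => F y i) := fun i =>
    hFc.comp_left (g := fun z : Ambient k => z i) rfl
  have hint : ∀ i u j v, Integrable (fun y => fderiv ℝ F y u i * fderiv ℝ F y v j) := by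
    intro i u j v
    refine Continuous.integrable_of_hasCompactSupport (by fun_prop) ?_
    have h := ((hcs i).fderiv_apply ℝ u).mul_right (f' := fun y => fderiv ℝ F y v j)
    simp_rw [hd] at h
    exact h
  unfold traceForm
  have hterm : ∀ i j, Integrable (fun y => fderiv ℝ F y (EuclideanSpace.single i 1) i *
      fderiv ℝ F y (EuclideanSpace.single j 1) j - fderiv ℝ F y (EuclideanSpace.single j 1) i *
        fderiv ℝ F y (EuclideanSpace.single i 1) j) :=
    fun i j => (hint _ _ _ _).sub (hint _ _ _ _)
  rw [integral_finsetSum _ fun i _ => integrable_finsetSum _ fun j _ => hterm i j]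
  refine Finset.sum_eq_zero fun i _ => ?_
  rw [integral_finsetSum _ fun j _ => hterm i j]
  refine Finset.sum_eq_zero fun j _ => ?_
  rw [integral_sub (hint _ _ _ _) (hint _ _ _ _), sub_eq_zero]
  have h := integral_fderiv_mul_fderiv_comm volume (hcoord i) (hcoord j) (hcs i)
    (EuclideanSpace.single i 1) (EuclideanSpace.single j 1)
  simpa only [hd] using h

/-! ### Polar coordinates and the radial weight -/

instance : IsFiniteMeasure (sphVol k) := by unfold sphVol; infer_instance

lemma integral_volumeIoiPow (n : ℕ) (a : ℝ → ℝ) :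
    ∫ r, a (r : ℝ) ∂(Measure.volumeIoiPow n) = ∫ r in Set.Ioi (0 : ℝ), r ^ n * a r := by
  simp only [Measure.volumeIoiPow, ENNReal.ofReal]
  rw [integral_withDensity_eq_integral_smul,
    integral_subtype_comap measurableSet_Ioi fun r => Real.toNNReal (r ^ n) • a r,
    setIntegral_congr_fun measurableSet_Ioi fun x hx ↦ ?_]
  · simp only [NNReal.smul_def, Real.coe_toNNReal _ (pow_nonneg (le_of_lt hx) _), smul_eq_mul]
  · exact (measurable_subtype_coe.pow_const _).real_toNNReal

lemma integrable_volumeIoiPow (n : ℕ) {a : ℝ → ℝ}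
    (ha : IntegrableOn (fun r => r ^ n * a r) (Set.Ioi 0)) :
    Integrable (fun r : Set.Ioi (0 : ℝ) => a r) (Measure.volumeIoiPow n) := by
  rw [Measure.volumeIoiPow, integrable_withDensity_iff_integrable_smul' (by fun_prop) (by simp)]
  rw [integrableOn_iff_comap_subtypeVal measurableSet_Ioi] at ha
  refine ha.congr (Eventually.of_forall fun r => ?_)
  have hr : (0 : ℝ) ≤ r := le_of_lt r.2
  simp [ENNReal.toReal_ofReal (pow_nonneg hr n)]

lemma integral_ambient_eq_prod (f : Ambient k → ℝ) :
    ∫ y, f y = ∫ p, f ((p.2 : ℝ) • (p.1 : Ambient k))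
      ∂((sphVol k).prod (Measure.volumeIoiPow (2 * k + 1))) := by
  have h := (volume : Measure (Ambient k)).measurePreserving_homeomorphUnitSphereProd.integral_comp
    (Homeomorph.measurableEmbedding _)
    (fun p : Sph k × Set.Ioi (0 : ℝ) => f ((p.2 : ℝ) • (p.1 : Ambient k)))
  have hfin : Module.finrank ℝ (Ambient k) - 1 = 2 * k + 1 := by simp
  rw [hfin] at h
  rw [sphVol, ← h, ← restrict_compl_singleton (μ := (volume : Measure (Ambient k))) 0,
    ← integral_subtype_comap (measurableSet_singleton (0 : Ambient k)).compl f,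
    restrict_compl_singleton]
  refine integral_congr_ae (Eventually.of_forall fun y => ?_)
  have hy : ‖(y : Ambient k)‖ ≠ 0 := norm_ne_zero_iff.2 y.2
  simp [homeomorphUnitSphereProd, smul_smul, hy]

lemma integral_ambient_of_separated {f : Ambient k → ℝ} {A B : Sph k → ℝ} {a b : ℝ → ℝ}
    (hf : ∀ (x : Sph k) (r : ℝ), 0 < r → f (r • (x : Ambient k)) = A x * a r + B x * b r)
    (hA : Integrable A (sphVol k)) (hB : Integrable B (sphVol k))
    (ha : IntegrableOn (fun r => r ^ (2 * k + 1) * a r) (Set.Ioi 0))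
    (hb : IntegrableOn (fun r => r ^ (2 * k + 1) * b r) (Set.Ioi 0)) :
    ∫ y, f y = (∫ x, A x ∂(sphVol k)) * (∫ r in Set.Ioi (0 : ℝ), r ^ (2 * k + 1) * a r) +
      (∫ x, B x ∂(sphVol k)) * (∫ r in Set.Ioi (0 : ℝ), r ^ (2 * k + 1) * b r) := by
  rw [integral_ambient_eq_prod, ← integral_volumeIoiPow, ← integral_volumeIoiPow,
    ← integral_prod_mul, ← integral_prod_mul, ← integral_add
      (hA.mul_prod (integrable_volumeIoiPow _ ha)) (hB.mul_prod (integrable_volumeIoiPow _ hb))]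
  refine integral_congr_ae (Eventually.of_forall fun p => ?_)
  exact hf p.1 p.2 p.2.2

/-- A smooth bump on the line, supported in `(1, 3)`. -/
def radialBump : ContDiffBump (2 : ℝ) := ⟨1 / 2, 1, by norm_num, by norm_num⟩

lemma radialBump_eq_zero {t : ℝ} (ht : t ≤ 1 ∨ 3 ≤ t) : radialBump t = 0 := by
  refine radialBump.zero_of_le_dist ?_
  rw [Real.dist_eq]
  change (1 : ℝ) ≤ _
  rcases ht with h | h
  · rw [abs_of_nonpos (by linarith)]; linarith
  · rw [abs_of_nonneg (by linarith)]; linarith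

lemma hasDerivAt_radialBump (t : ℝ) : HasDerivAt radialBump (deriv radialBump t) t :=
  (radialBump.contDiff (n := 1)).differentiable (by norm_num) t |>.hasDerivAt

lemma continuous_deriv_radialBump : Continuous (deriv radialBump) :=
  (radialBump.contDiff (n := 1)).continuous_deriv le_rfl

/-- The radial part of the integration by parts, the vanishing of the integral of the derivative
of `r ^ (2 * k) * radialBump (r ^ 2) ^ 2`, with the positivity of the first integral. -/
lemma radial_integrals (k : ℕ) :
    IntegrableOn (fun r : ℝ => r ^ (2 * k + 1) * (radialBump (r ^ 2) * r⁻¹) ^ 2) (Set.Ioi 0) ∧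
    IntegrableOn (fun r : ℝ => r ^ (2 * k + 1) *
      (4 * radialBump (r ^ 2) * deriv radialBump (r ^ 2))) (Set.Ioi 0) ∧
    0 < ∫ r in Set.Ioi (0 : ℝ), r ^ (2 * k + 1) * (radialBump (r ^ 2) * r⁻¹) ^ 2 ∧
    ∫ r in Set.Ioi (0 : ℝ), r ^ (2 * k + 1) * (4 * radialBump (r ^ 2) * deriv radialBump (r ^ 2)) =
      -(2 * k) * ∫ r in Set.Ioi (0 : ℝ), r ^ (2 * k + 1) * (radialBump (r ^ 2) * r⁻¹) ^ 2 := by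
  have hβ : Continuous radialBump := radialBump.continuous
  have hzero : ∀ r : ℝ, r ∉ Set.Icc (-2 : ℝ) 2 → radialBump (r ^ 2) = 0 := by
    intro r hr
    refine radialBump_eq_zero (Or.inr ?_)
    rw [Set.mem_Icc, not_and_or, not_le, not_le] at hr
    rcases hr with h | h <;> nlinarith
  have hcont1 : Continuous fun r : ℝ => r ^ (2 * k + 1) * (radialBump (r ^ 2) * r⁻¹) ^ 2 := by
    have hinv : Continuous fun r : ℝ => radialBump (r ^ 2) * r⁻¹ := by
      rw [continuous_iff_continuousAt]
      intro r
      rcases eq_or_ne r 0 with rfl | hr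
      -- The bump vanishes for r² ≤ 1, which removes the singularity of r⁻¹.
      · have : (fun r : ℝ => radialBump (r ^ 2) * r⁻¹) =ᶠ[𝓝 0] fun _ => 0 := by
          filter_upwards [Ioo_mem_nhds (show (-1 : ℝ) < 0 by norm_num) one_pos] with r hr
          rw [radialBump_eq_zero (Or.inl (by nlinarith [hr.1, hr.2])), zero_mul]
        exact continuousAt_const.congr this.symm
      · exact (hβ.comp (continuous_pow 2)).continuousAt.mul (continuousAt_inv₀ hr)
    exact (continuous_pow _).mul (hinv.pow 2)
  have hcs1 : HasCompactSupport
      fun r : ℝ => r ^ (2 * k + 1) * (radialBump (r ^ 2) * r⁻¹) ^ 2 :=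
    HasCompactSupport.intro (isCompact_Icc (a := (-2 : ℝ)) (b := 2)) fun r hr => by simp [hzero r hr]
  have hi1 := hcont1.integrable_of_hasCompactSupport hcs1 (μ := volume)
  have hcont2 : Continuous fun r : ℝ => r ^ (2 * k + 1) *
      (4 * radialBump (r ^ 2) * deriv radialBump (r ^ 2)) :=
    (continuous_pow _).mul ((continuous_const.mul (hβ.comp (continuous_pow 2))).mul
      (continuous_deriv_radialBump.comp (continuous_pow 2)))
  have hcs2 : HasCompactSupport fun r : ℝ => r ^ (2 * k + 1) *
      (4 * radialBump (r ^ 2) * deriv radialBump (r ^ 2)) :=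
    HasCompactSupport.intro (isCompact_Icc (a := (-2 : ℝ)) (b := 2)) fun r hr => by simp [hzero r hr]
  have hi2 := hcont2.integrable_of_hasCompactSupport hcs2 (μ := volume)
  refine ⟨hi1.integrableOn, hi2.integrableOn, ?_, ?_⟩
  · rw [setIntegral_pos_iff_support_of_nonneg_ae _ hi1.integrableOn]
    -- For r in this interval r² lies in (1.69, 2.25), inside [1.5, 2.5] where the bump equals 1.
    · have hopen : IsOpen (Set.Ioo (1.3 : ℝ) 1.5) := isOpen_Ioo
      refine lt_of_lt_of_le (hopen.measure_pos volume ⟨1.4, by norm_num, by norm_num⟩)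
        (measure_mono fun r hr => ⟨?_, ?_⟩)
      · have hr0 : 0 < r := by linarith [hr.1]
        have : radialBump (r ^ 2) = 1 := by
          refine radialBump.one_of_mem_closedBall ?_
          rw [Metric.mem_closedBall, Real.dist_eq, abs_le]
          change -(1 / 2 : ℝ) ≤ _ ∧ _ ≤ (1 / 2 : ℝ)
          constructor <;> nlinarith [hr.1, hr.2]
        rw [Function.mem_support, this]
        positivity
      · exact lt_trans (by norm_num) hr.1
    · filter_upwards [ae_restrict_mem measurableSet_Ioi] with r hr
      have hr0 : (0 : ℝ) < r := hr
      simp only [Pi.zero_apply]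
      positivity
  · have hder : ∀ r ∈ Set.Ioi (0 : ℝ), HasDerivAt (fun r : ℝ => r ^ (2 * k) * radialBump (r ^ 2) ^ 2)
        (r ^ (2 * k + 1) * (4 * radialBump (r ^ 2) * deriv radialBump (r ^ 2)) +
          2 * k * (r ^ (2 * k + 1) * (radialBump (r ^ 2) * r⁻¹) ^ 2)) r := by
      intro r hr
      have hr0 : r ≠ 0 := (show (0 : ℝ) < r from hr).ne'
      have h1 := (hasDerivAt_radialBump (r ^ 2)).comp r (hasDerivAt_pow 2 r)
      have h2 := (hasDerivAt_pow (2 * k) r).mul (h1.pow 2)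
      refine h2.congr_deriv ?_
      simp only [Function.comp_def, Pi.pow_apply]
      -- The exponent 2k − 1 is a truncated subtraction, so k = 0 is treated apart.
      rcases k with _ | k
      · simp
        ring
      · have e : 2 * (k + 1) - 1 = 2 * k + 1 := by omega
        rw [e]
        field_simp
        push_cast
        ring
    have hint : IntegrableOn (fun r : ℝ => r ^ (2 * k + 1) *
        (4 * radialBump (r ^ 2) * deriv radialBump (r ^ 2)) +
          2 * k * (r ^ (2 * k + 1) * (radialBump (r ^ 2) * r⁻¹) ^ 2)) (Set.Ioi 0) :=
      (hi2.add (hi1.const_mul _)).integrableOn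
    have hcontf : Continuous fun r : ℝ => r ^ (2 * k) * radialBump (r ^ 2) ^ 2 :=
      (continuous_pow _).mul ((hβ.comp (continuous_pow 2)).pow 2)
    have htop : Tendsto (fun r : ℝ => r ^ (2 * k) * radialBump (r ^ 2) ^ 2) atTop (𝓝 0) := by
      refine tendsto_const_nhds.congr' ?_
      filter_upwards [eventually_gt_atTop (2 : ℝ)] with r hr
      rw [hzero r (fun h => absurd h.2 (not_le.2 hr))]
      simp
    have h := integral_Ioi_of_hasDerivAt_of_tendsto hcontf.continuousWithinAt hder hint htop
    rw [integral_add hi2.integrableOn (hi1.integrableOn.const_mul _), integral_const_mul] at h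
    have h0 : radialBump ((0 : ℝ) ^ 2) = 0 := radialBump_eq_zero (Or.inl (by norm_num))
    rw [h0] at h
    simp only [ne_eq, OfNat.ofNat_ne_zero, not_false_eq_true, zero_pow, mul_zero, sub_zero] at h
    linarith

/-! ### The Bochner formula on the whole sphere -/

lemma continuous_of_contDiffAt_radialExt {V : Sph k → Ambient k}
    (hV : ∀ y, y ≠ 0 → ContDiffAt ℝ ∞ (radialExt V) y) : Continuous V := by
  have h : Continuous fun x : Sph k => radialExt V x := by
    rw [continuous_iff_continuousAt]
    intro x
    exact (hV x x.ne_zero).continuousAt.comp continuous_subtype_val.continuousAt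
  simpa only [radialExt_coe] using h

lemma continuousAt_extDeriv {V : Sph k → Ambient k} {x : Sph k}
    (hV : ContDiffAt ℝ ∞ (radialExt V) x) : ContinuousAt (extDeriv V) x :=
  (hV.fderiv_right (m := 0) (by norm_num)).continuousAt.comp continuous_subtype_val.continuousAt

/-- The integrated Bochner formula for tangent vector fields on the sphere. -/
theorem integral_traceForm_extDeriv {V : Sph k → Ambient k}
    (hV : ∀ y, y ≠ 0 → ContDiffAt ℝ ∞ (radialExt V) y)
    (ht : ∀ x : Sph k, ⟪(x : Ambient k), V x⟫ = 0) :
    ∫ x, traceForm (extDeriv V x) ∂(sphVol k) = 2 * k * ∫ x, ‖V x‖ ^ 2 ∂(sphVol k) := by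
  let F : Ambient k → Ambient k := fun y => radialBump (‖y‖ ^ 2) • radialExt V y
  have hFs : ContDiff ℝ 2 F := by
    rw [contDiff_iff_contDiffAt]
    intro y
    rcases eq_or_ne y 0 with rfl | hy
    · have : F =ᶠ[𝓝 0] fun _ => 0 := by
        filter_upwards [Metric.ball_mem_nhds (0 : Ambient k) one_pos] with y hy
        have hy1 : ‖y‖ < 1 := by simpa using hy
        simp only [F]
        rw [radialBump_eq_zero (Or.inl (by nlinarith [norm_nonneg y])), zero_smul]
      exact contDiffAt_const.congr_of_eventuallyEq this
    · have h1 : ContDiff ℝ 2 fun y : Ambient k => radialBump (‖y‖ ^ 2) :=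
        radialBump.contDiff.comp (contDiff_norm_sq ℝ)
      exact h1.contDiffAt.smul ((hV y hy).of_le (by norm_cast))
  have hFc : HasCompactSupport F := by
    refine HasCompactSupport.intro (isCompact_closedBall (0 : Ambient k) 2) fun y hy => ?_
    have hy2 : 2 < ‖y‖ := by simpa using hy
    simp only [F]
    rw [radialBump_eq_zero (Or.inr (by nlinarith)), zero_smul]
  have hpt : ∀ (x : Sph k) (r : ℝ), 0 < r → traceForm (fderiv ℝ F (r • (x : Ambient k))) =
      traceForm (extDeriv V x) * (radialBump (r ^ 2) * r⁻¹) ^ 2 +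
        ‖V x‖ ^ 2 * (4 * radialBump (r ^ 2) * deriv radialBump (r ^ 2)) := by
    intro x r hr
    have hx1 : ‖(x : Ambient k)‖ = 1 := norm_eq_of_mem_sphere x
    have hne : r • (x : Ambient k) ≠ 0 := smul_ne_zero hr.ne' x.ne_zero
    have hn : ‖r • (x : Ambient k)‖ = r := by rw [norm_smul, hx1, mul_one, Real.norm_of_nonneg hr.le]
    have hG : HasFDerivAt (radialExt V) (r⁻¹ • extDeriv V x) (r • (x : Ambient k)) := by
      rw [← fderiv_radialExt_smul V x hr]
      exact ((hV _ hne).differentiableAt (by simp)).hasFDerivAt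
    have hc := (hasDerivAt_radialBump (‖r • (x : Ambient k)‖ ^ 2)).comp_hasFDerivAt
      (r • (x : Ambient k)) (hasStrictFDerivAt_norm_sq (r • (x : Ambient k))).hasFDerivAt
    have hF := (hc.smul hG).fderiv
    have hVx : radialExt V (r • (x : Ambient k)) = V x := by
      rw [radialExt_smul V hr, radialExt_coe]
    -- Product rule: differentiating the cutoff contributes the rank-one map along x with values in
    -- the line of V x.
    have hF' : fderiv ℝ F (r • (x : Ambient k)) = (radialBump (r ^ 2) * r⁻¹) • extDeriv V x +
        ((2 * deriv radialBump (r ^ 2) * r) • innerSL ℝ (x : Ambient k)).smulRight (V x) := by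
      refine Eq.trans hF ?_
      ext u i
      simp [hVx, hn]
      ring
    have hd : DifferentiableAt ℝ (radialExt V) (x : Ambient k) :=
      (hV _ x.ne_zero).differentiableAt (by simp)
    rw [hF', traceForm_add_smulRight _ _ _ (by simp [ht x]), traceForm_smul]
    -- This gives ⟪x, D (V x)⟫ = −‖V x‖², which turns the cross term into 4ββ′‖V x‖², with β and β′
    -- taken at r².
    have hi := inner_extDeriv hd (Eventually.of_forall ht) (V x)
    rw [real_inner_self_eq_norm_sq] at hi
    simp only [smul_apply, map_smul, smul_eq_mul,
      innerSL_apply_apply, hi]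
    field_simp
    ring
  have hVc := continuous_of_contDiffAt_radialExt hV
  have hDc : Continuous (extDeriv V) := continuous_iff_continuousAt.2 fun x =>
    continuousAt_extDeriv (hV x x.ne_zero)
  have hbdd : ∀ f : Sph k → ℝ, Continuous f → Integrable f (sphVol k) := fun f hf =>
    hf.integrable_of_hasCompactSupport (HasCompactSupport.of_compactSpace f)
  obtain ⟨hi1, hi2, hpos, hrel⟩ := radial_integrals k
  have h := integral_ambient_of_separated (f := fun y => traceForm (fderiv ℝ F y))
    (A := fun x => traceForm (extDeriv V x)) (B := fun x => ‖V x‖ ^ 2) hpt (hbdd _ (continuous_traceForm.comp hDc))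
    (hbdd _ (hVc.norm.pow 2)) hi1 hi2
  rw [integral_traceForm_fderiv hFs hFc, hrel] at h
  refine mul_right_cancel₀ hpos.ne' ?_
  linarith

/-! ### Traces and norms on the tangent space -/

lemma mem_tan_iff {x : Sph k} {u : Ambient k} : u ∈ Tan x ↔ ⟪(x : Ambient k), u⟫ = 0 :=
  Submodule.mem_orthogonal_singleton_iff_inner_right

lemma finrank_tan (x : Sph k) : Module.finrank ℝ (Tan x) = 2 * k + 1 := by
  have : Fact (Module.finrank ℝ (Ambient k) = 2 * k + 1 + 1) := ⟨finrank_euclideanSpace_fin⟩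
  exact Submodule.finrank_orthogonal_span_singleton x.ne_zero

lemma coe_tanProj (x : Sph k) (u : Ambient k) :
    ((Tan x).orthogonalProjectionOnto u : Ambient k) = u - ⟪(x : Ambient k), u⟫ • (x : Ambient k) := by
  rw [Submodule.coe_orthogonalProjectionOnto_apply]
  refine Submodule.eq_starProjection_of_mem_of_inner_eq_zero ?_ ?_
  · rw [mem_tan_iff, inner_sub_right, real_inner_smul_right, real_inner_self_eq_norm_sq,
      norm_eq_of_mem_sphere]
    ring
  · intro w hw
    rw [mem_tan_iff] at hw
    rw [sub_sub_cancel, real_inner_smul_left, hw, mul_zero]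

lemma norm_tanProj_sq (x : Sph k) (u : Ambient k) :
    ‖(Tan x).orthogonalProjectionOnto u‖ ^ 2 = ‖u‖ ^ 2 - ⟪(x : Ambient k), u⟫ ^ 2 := by
  rw [Submodule.coe_norm, coe_tanProj, norm_sub_sq_real, real_inner_smul_right, norm_smul,
    norm_eq_of_mem_sphere, real_inner_comm, Real.norm_eq_abs, mul_one, sq_abs]
  ring

/-- A linear map of the ambient space that kills `x` has the same trace as its compression to the
tangent space at `x`. -/
lemma trace_compression (x : Sph k) (B : Ambient k →L[ℝ] Ambient k) (hB : B x = 0) :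
    LinearMap.trace ℝ (Tan x)
      ((Tan x).orthogonalProjectionOnto ∘L B ∘L (Tan x).subtypeL).toLinearMap =
        LinearMap.trace ℝ (Ambient k) B.toLinearMap := by
  have h := LinearMap.trace_comp_comm' (R := ℝ) (B ∘L (Tan x).subtypeL).toLinearMap
    ((Tan x).orthogonalProjectionOnto).toLinearMap
  refine Eq.trans h ?_
  congr 1
  ext1 u
  change B ((Tan x).orthogonalProjectionOnto u : Ambient k) = B u
  rw [coe_tanProj]
  simp [hB]

lemma extDeriv_tanProj (v : Sph k → Ambient k) (x : Sph k) (u : Ambient k) :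
    extDeriv v x ((Tan x).orthogonalProjectionOnto u : Ambient k) = extDeriv v x u := by
  rw [coe_tanProj]
  simp [extDeriv_self]

lemma covDeriv_apply (v : Sph k → Ambient k) (x : Sph k) (u : Tan x) :
    covDeriv v x u = (Tan x).orthogonalProjectionOnto (extDeriv v x u) := rfl

lemma divergence_eq_trace (v : Sph k → Ambient k) (x : Sph k) :
    divergence v x = LinearMap.trace ℝ (Ambient k) (extDeriv v x).toLinearMap :=
  trace_compression x (extDeriv v x) (extDeriv_self v x)

lemma trace_covDeriv_sq (v : Sph k → Ambient k) (x : Sph k) :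
    LinearMap.trace ℝ (Tan x) ((covDeriv v x).toLinearMap ∘ₗ (covDeriv v x).toLinearMap) =
      LinearMap.trace ℝ (Ambient k) ((extDeriv v x).toLinearMap ∘ₗ (extDeriv v x).toLinearMap) := by
  rw [← ContinuousLinearMap.toLinearMap_comp, ← ContinuousLinearMap.toLinearMap_comp,
    ← trace_compression x (extDeriv v x ∘L extDeriv v x) (by simp [extDeriv_self])]
  congr 1
  ext1 u
  change covDeriv v x (covDeriv v x u) = _
  rw [covDeriv_apply v x (covDeriv v x u), covDeriv_apply v x u, extDeriv_tanProj]
  rfl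

lemma traceForm_extDeriv (v : Sph k → Ambient k) (x : Sph k) :
    traceForm (extDeriv v x) = divergence v x ^ 2 -
      LinearMap.trace ℝ (Tan x) ((covDeriv v x).toLinearMap ∘ₗ (covDeriv v x).toLinearMap) := by
  rw [traceForm_eq, divergence_eq_trace, trace_covDeriv_sq]

/-- Expand 0 ≤ ‖A + Aᵀ‖² = 2‖A‖² + 2 tr(A²) in matrix entries. -/
lemma neg_trace_sq_le_sum_norm_sq {T ι : Type*} [NormedAddCommGroup T] [InnerProductSpace ℝ T]
    [Fintype ι] (b : OrthonormalBasis ι ℝ T) (A : T →ₗ[ℝ] T) :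
    -LinearMap.trace ℝ T (A ∘ₗ A) ≤ ∑ a, ‖A (b a)‖ ^ 2 := by
  classical
  have h1 : ∀ a, ‖A (b a)‖ ^ 2 = ∑ c, ⟪b c, A (b a)⟫ ^ 2 := by
    intro a
    rw [← b.sum_sq_norm_inner_right]
    simp
  have h2 : ∀ a, ⟪b a, A (A (b a))⟫ = ∑ c, ⟪b a, A (b c)⟫ * ⟪b c, A (b a)⟫ := by
    intro a
    conv_lhs => rw [← b.sum_repr' (A (b a))]
    simp [inner_sum, real_inner_smul_right, mul_comm]
  rw [LinearMap.trace_eq_sum_inner _ b]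
  simp only [LinearMap.comp_apply, h1, h2]
  have h3 : ∑ a, ∑ c, ⟪b c, A (b a)⟫ ^ 2 = ∑ a, ∑ c, ⟪b a, A (b c)⟫ ^ 2 := Finset.sum_comm
  have h4 : 0 ≤ ∑ a, ∑ c, (⟪b a, A (b c)⟫ + ⟪b c, A (b a)⟫) ^ 2 := by positivity
  have h5 : ∑ a, ∑ c, (⟪b a, A (b c)⟫ + ⟪b c, A (b a)⟫) ^ 2 = ∑ a, ∑ c, ⟪b a, A (b c)⟫ ^ 2 +
      2 * ∑ a, ∑ c, ⟪b a, A (b c)⟫ * ⟪b c, A (b a)⟫ + ∑ a, ∑ c, ⟪b c, A (b a)⟫ ^ 2 := by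
    simp only [Finset.mul_sum, ← Finset.sum_add_distrib]
    refine Finset.sum_congr rfl fun a _ => Finset.sum_congr rfl fun c _ => ?_
    ring
  linarith

lemma traceForm_extDeriv_le {v : Sph k → Ambient k} {x : Sph k} (h : divergence v x = 0) :
    traceForm (extDeriv v x) ≤ normSqCovDeriv v x := by
  rw [traceForm_extDeriv, h]
  have := neg_trace_sq_le_sum_norm_sq (stdOrthonormalBasis ℝ (Tan x)) (covDeriv v x).toLinearMap
  simpa [normSqCovDeriv] using this

/-- The chosen basis of `Tan x` need not vary continuously with x; a fixed ambient basis makes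
continuity in x accessible. Both sums are the trace of Lᵀ P L, where P is the tangential projection
and L kills x. -/
lemma normSqCovDeriv_eq (v : Sph k → Ambient k) (x : Sph k) :
    normSqCovDeriv v x = ∑ i, (‖extDeriv v x (EuclideanSpace.single i 1)‖ ^ 2 -
      ⟪(x : Ambient k), extDeriv v x (EuclideanSpace.single i 1)⟫ ^ 2) := by
  set L := extDeriv v x with hL
  let P : Ambient k →L[ℝ] Ambient k := (Tan x).subtypeL ∘L (Tan x).orthogonalProjectionOnto
  let B : Ambient k →L[ℝ] Ambient k := ContinuousLinearMap.adjoint L ∘L P ∘L L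
  have hB := trace_compression x B (by simp [B, hL, extDeriv_self])
  rw [LinearMap.trace_eq_sum_inner _ (stdOrthonormalBasis ℝ (Tan x)),
    LinearMap.trace_eq_sum_inner _ (EuclideanSpace.basisFun _ ℝ)] at hB
  have hnorm : ∀ u : Ambient k, ⟪u, B u⟫ = ‖(Tan x).orthogonalProjectionOnto (L u)‖ ^ 2 := by
    intro u
    simp only [B, ContinuousLinearMap.comp_apply, ContinuousLinearMap.adjoint_inner_right, P,
      Submodule.subtypeL_apply]
    rw [← Submodule.inner_orthogonalProjectionOnto_eq_of_mem_right, real_inner_self_eq_norm_sq]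
  have hl : ∀ a, ⟪stdOrthonormalBasis ℝ (Tan x) a, ((Tan x).orthogonalProjectionOnto ∘L B ∘L
      (Tan x).subtypeL) (stdOrthonormalBasis ℝ (Tan x) a)⟫ =
        ‖covDeriv v x (stdOrthonormalBasis ℝ (Tan x) a)‖ ^ 2 := by
    intro a
    rw [covDeriv_apply, ← hL, ← hnorm]
    exact Submodule.inner_orthogonalProjectionOnto_eq_of_mem_left _ _
  simp only [ContinuousLinearMap.coe_coe, hl, hnorm, norm_tanProj_sq, EuclideanSpace.basisFun_apply] at hB
  exact hB

/-! ### Hopf flows -/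

section Hopf

variable {H : Sph k → Ambient k} {J : Ambient k ≃ₗᵢ[ℝ] Ambient k}

lemma inner_complexStructure (hJ : ∀ y, J (J y) = -y) (u w : Ambient k) :
    ⟪J u, w⟫ = -⟪u, J w⟫ := by
  rw [← J.inner_map_map (J u) w, hJ, inner_neg_left]

lemma contDiffAt_radialExt_hopf (hH : ∀ x : Sph k, H x = J x) {y : Ambient k} (hy : y ≠ 0) :
    ContDiffAt ℝ ∞ (radialExt H) y := by
  have h : ContDiffAt ℝ ∞ (fun z : Ambient k => J (‖z‖⁻¹ • z)) y :=
    J.toContinuousLinearEquiv.contDiff.contDiffAt.comp y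
      (((contDiffAt_norm ℝ hy).inv (norm_ne_zero_iff.2 hy)).smul contDiffAt_id)
  refine h.congr_of_eventuallyEq ?_
  filter_upwards [isOpen_compl_singleton.mem_nhds hy] with z hz
  rw [radialExt_of_ne_zero H hz, hH, coe_direction hz]

/-- Differentiate ‖y‖ · `radialExt H y` = J y: the norm has zero derivative along tangent
directions. -/
lemma extDeriv_hopf (hH : ∀ x : Sph k, H x = J x) {x : Sph k} {u : Ambient k} (hu : u ∈ Tan x) :
    extDeriv H x u = J u := by
  have hx1 : ‖(x : Ambient k)‖ = 1 := norm_eq_of_mem_sphere x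
  have hN : HasFDerivAt (fun y : Ambient k => ‖y‖) (fderiv ℝ (fun y : Ambient k => ‖y‖) x)
      (x : Ambient k) :=
    ((contDiffAt_norm ℝ x.ne_zero (n := 1)).differentiableAt (by norm_num)).hasFDerivAt
  have hNu : fderiv ℝ (fun y : Ambient k => ‖y‖) x u = 0 := by
    have h1 := (hN.pow 2).unique (hasStrictFDerivAt_norm_sq (x : Ambient k)).hasFDerivAt
    have h2 := congrArg (fun A : Ambient k →L[ℝ] ℝ => A u) h1
    simpa [hx1, mem_tan_iff.1 hu] using h2
  have hD : HasFDerivAt (radialExt H) (extDeriv H x) (x : Ambient k) :=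
    ((contDiffAt_radialExt_hopf hH x.ne_zero).differentiableAt (by simp)).hasFDerivAt
  have heq : (fun y : Ambient k => ‖y‖ • radialExt H y) = J := by
    funext y
    by_cases hy : y = 0
    · simp [hy]
    · rw [radialExt_of_ne_zero H hy, hH, coe_direction hy, map_smul, smul_smul,
        mul_inv_cancel₀ (norm_ne_zero_iff.2 hy), one_smul]
  have h1 := hN.smul hD
  have h2 : HasFDerivAt (fun y : Ambient k => ‖y‖ • radialExt H y)
      (J.toContinuousLinearEquiv : Ambient k →L[ℝ] Ambient k) (x : Ambient k) := by
    rw [heq]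
    exact J.toContinuousLinearEquiv.hasFDerivAt
  have h3 := congrArg (fun A : Ambient k →L[ℝ] Ambient k => A u) (h1.unique h2)
  simpa [hx1, hNu] using h3

lemma hopf_mem_tan (hJ : ∀ y, J (J y) = -y) (x : Sph k) : J x ∈ Tan x := by
  rw [mem_tan_iff]
  have h := inner_complexStructure hJ (x : Ambient k) x
  rw [real_inner_comm] at h
  linarith

/-- ∇ₑH is Je without its x-component, so ‖∇ₑH‖² = 1 − ⟪e, Jx⟫² for unit e. Over the 2k + 1 basis
vectors this sums to (2k + 1) − ‖Jx‖². -/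
lemma normSqCovDeriv_hopf (hJ : ∀ y, J (J y) = -y) (hH : ∀ x : Sph k, H x = J x) (x : Sph k) :
    normSqCovDeriv H x = 2 * k := by
  have hterm : ∀ e : Tan x, ‖covDeriv H x e‖ ^ 2 =
      ‖e‖ ^ 2 - ⟪e, (⟨J x, hopf_mem_tan hJ x⟩ : Tan x)⟫ ^ 2 := by
    intro e
    have hJe : ‖J (e : Ambient k)‖ = ‖e‖ := by simp
    have hxe : ⟪(x : Ambient k), J (e : Ambient k)⟫ = -⟪(e : Ambient k), J (x : Ambient k)⟫ := by
      rw [real_inner_comm, inner_complexStructure hJ]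
    rw [covDeriv_apply, extDeriv_hopf hH e.2, norm_tanProj_sq, hJe, hxe, Submodule.coe_inner,
      neg_sq]
  have hsum := (stdOrthonormalBasis ℝ (Tan x)).sum_sq_norm_inner_right
    (⟨J x, hopf_mem_tan hJ x⟩ : Tan x)
  have hn : ‖(⟨J x, hopf_mem_tan hJ x⟩ : Tan x)‖ = 1 := by
    rw [Submodule.coe_norm]
    simp
  simp only [Real.norm_eq_abs, sq_abs, hn] at hsum
  simp only [normSqCovDeriv, hterm, Finset.sum_sub_distrib, hsum]
  simp [finrank_tan]

lemma inner_covDeriv_hopf (hJ : ∀ y, J (J y) = -y) (hH : ∀ x : Sph k, H x = J x) {x : Sph k}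
    (u w : Tan x) : ⟪u, covDeriv H x w⟫ = -⟪covDeriv H x u, w⟫ := by
  rw [covDeriv_apply, covDeriv_apply, extDeriv_hopf hH u.2, extDeriv_hopf hH w.2,
    Submodule.inner_orthogonalProjectionOnto_eq_of_mem_left,
    Submodule.inner_orthogonalProjectionOnto_eq_of_mem_right, inner_complexStructure hJ, neg_neg]

/-- ∇H is skew, so tr ∇H = 0 and −tr((∇H)²) = ‖∇H‖². -/
lemma traceForm_extDeriv_hopf (hJ : ∀ y, J (J y) = -y) (hH : ∀ x : Sph k, H x = J x)
    (x : Sph k) : traceForm (extDeriv H x) = 2 * k := by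
  have hdiv : divergence H x = 0 := by
    rw [divergence, LinearMap.trace_eq_sum_inner _ (stdOrthonormalBasis ℝ (Tan x))]
    refine Finset.sum_eq_zero fun a _ => ?_
    have h := inner_covDeriv_hopf hJ hH (stdOrthonormalBasis ℝ (Tan x) a)
      (stdOrthonormalBasis ℝ (Tan x) a)
    rw [real_inner_comm] at h
    rw [real_inner_comm]
    change ⟪covDeriv H x _, _⟫ = (0 : ℝ)
    linarith
  rw [traceForm_extDeriv, hdiv, ← normSqCovDeriv_hopf hJ hH x,
    LinearMap.trace_eq_sum_inner _ (stdOrthonormalBasis ℝ (Tan x)), normSqCovDeriv,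
    zero_pow two_ne_zero, zero_sub, ← Finset.sum_neg_distrib]
  refine Finset.sum_congr rfl fun a _ => ?_
  change -⟪_, covDeriv H x (covDeriv H x _)⟫ = _
  rw [inner_covDeriv_hopf hJ hH, neg_neg, real_inner_self_eq_norm_sq]

end Hopf

/-! ### Derivatives on a zero set -/

/-- Almost everywhere on a closed set where `g` vanishes, its derivative vanishes as well. -/
lemma ae_extDeriv_eq_zero {g : Sph k → Ambient k} {Z : Set (Sph k)} (hZ : IsClosed Z)
    (hg : ∀ x ∈ Z, g x = 0)
    (hd : ∀ y, y ≠ 0 → direction y ∈ Z → ContDiffAt ℝ ∞ (radialExt g) y) :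
    ∀ᵐ x ∂(sphVol k), x ∈ Z → extDeriv g x = 0 := by
  let s : Set (Ambient k) := direction ⁻¹' Z ∩ {0}ᶜ
  have hs : MeasurableSet s := by
    have hc : ContinuousOn (direction (k := k)) {0}ᶜ := fun y hy =>
      (continuousAt_direction hy).continuousWithinAt
    obtain ⟨t, ht, hst⟩ := continuousOn_iff_isClosed.1 hc Z hZ
    change MeasurableSet (direction ⁻¹' Z ∩ {0}ᶜ)
    rw [hst]
    exact ht.measurableSet.inter (measurableSet_singleton _).compl
  -- On the cone over Z the extension vanishes, so the zero map approximates it with constant 0;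
  -- this forces its derivative to vanish almost everywhere there.
  have happ : ApproximatesLinearOn (radialExt g) (0 : Ambient k →L[ℝ] Ambient k) s 0 := by
    intro y hy z hz
    rw [radialExt_of_ne_zero g hy.2, radialExt_of_ne_zero g hz.2, hg _ hy.1, hg _ hz.1]
    simp
  have hae := happ.norm_fderiv_sub_le volume hs (fderiv ℝ (radialExt g)) fun y hy =>
    ((hd y hy.2 hy.1).differentiableAt (by simp)).hasFDerivAt.hasFDerivWithinAt
  rw [ae_restrict_iff' hs] at hae
  have hcont : ContinuousOn (extDeriv g) Z := fun x hx =>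
    (continuousAt_extDeriv (hd x x.ne_zero (by rwa [direction_coe]))).continuousWithinAt
  have hN : MeasurableSet (Z \ (Z ∩ extDeriv g ⁻¹' {0})) :=
    hZ.measurableSet.diff (hcont.preimage_isClosed_of_isClosed hZ isClosed_singleton).measurableSet
  have hnull : sphVol k (Z \ (Z ∩ extDeriv g ⁻¹' {0})) = 0 := by
    -- The sphere measure is computed from the cone over the bad set. By homogeneity a derivative
    -- that is nonzero at x is nonzero along the ray of x, so this cone lies in the Lebesgue-null
    -- set.
    rw [sphVol, Measure.toSphere_apply' _ hN]
    refine mul_eq_zero_of_right _ (measure_mono_null ?_ (mem_ae_iff.1 hae))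
    rintro _ ⟨r, hr, _, ⟨x, hx, rfl⟩, rfl⟩
    intro hcon
    have hr0 : 0 < r := hr.1
    have h0 := hcon ⟨by simpa [direction_smul x hr0] using hx.1, smul_ne_zero hr0.ne' (Sph.ne_zero x)⟩
    simp only [fderiv_radialExt_smul g x hr0, sub_zero, nonpos_iff_eq_zero, nnnorm_eq_zero,
      smul_eq_zero, inv_eq_zero, hr0.ne', false_or] at h0
    exact hx.2 ⟨hx.1, h0⟩
  filter_upwards [compl_mem_ae_iff.2 hnull] with x hx hxZ
  by_contra hne
  exact hx ⟨hxZ, fun h => hne h.2⟩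

/-! ### Truncations of the identity near zero -/

section Cutoff

/-- A smooth truncation of the identity that vanishes on the unit ball. -/
def truncation (z : Ambient k) : Ambient k := Real.smoothTransition (‖z‖ ^ 2 - 1) • z

lemma contDiff_truncation : ContDiff ℝ ∞ (truncation (k := k)) :=
  (Real.smoothTransition.contDiff.comp ((contDiff_norm_sq ℝ).sub contDiff_const)).smul contDiff_id

lemma truncation_eq_zero {z : Ambient k} (hz : ‖z‖ ≤ 1) : truncation z = 0 := by
  rw [truncation, Real.smoothTransition.zero_of_nonpos (by nlinarith [norm_nonneg z]), zero_smul]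

lemma truncation_eq_self {z : Ambient k} (hz : 2 ≤ ‖z‖) : truncation z = z := by
  rw [truncation, Real.smoothTransition.one_of_one_le (by nlinarith), one_smul]

lemma norm_truncation_le (z : Ambient k) : ‖truncation z‖ ≤ ‖z‖ := by
  rw [truncation, norm_smul, Real.norm_of_nonneg (Real.smoothTransition.nonneg _)]
  exact mul_le_of_le_one_left (norm_nonneg z) (Real.smoothTransition.le_one _)

lemma fderiv_truncation_zero : fderiv ℝ (truncation (k := k)) 0 = 0 := by
  have h : truncation (k := k) =ᶠ[𝓝 0] fun _ => 0 := by
    filter_upwards [Metric.ball_mem_nhds (0 : Ambient k) one_pos] with z hz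
    exact truncation_eq_zero (by simpa using (Metric.mem_ball.1 hz).le)
  rw [h.fderiv_eq]
  simp

lemma fderiv_truncation_of_lt {z : Ambient k} (hz : 2 < ‖z‖) :
    fderiv ℝ (truncation (k := k)) z = ContinuousLinearMap.id ℝ _ := by
  have h : truncation (k := k) =ᶠ[𝓝 z] id := by
    filter_upwards [(isOpen_lt continuous_const continuous_norm).mem_nhds hz] with y hy
    exact truncation_eq_self (le_of_lt hy)
  rw [h.fderiv_eq, fderiv_id]

lemma exists_norm_fderiv_truncation_le :
    ∃ C, ∀ z, ‖fderiv ℝ (truncation (k := k)) z‖ ≤ C := by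
  obtain ⟨C, hC⟩ := (isCompact_closedBall (0 : Ambient k) 2).exists_bound_of_continuousOn
    (contDiff_truncation.continuous_fderiv (by simp)).continuousOn
  refine ⟨max C 1, fun z => ?_⟩
  by_cases hz : ‖z‖ ≤ 2
  · exact (hC z (by simpa using hz)).trans (le_max_left _ _)
  · rw [fderiv_truncation_of_lt (not_le.1 hz)]
    exact ContinuousLinearMap.norm_id_le.trans (le_max_right _ _)

/-- The rescaled truncation, which vanishes on the ball of radius `1 / m`. -/
def scaledTruncation (m : ℝ) (z : Ambient k) : Ambient k := m⁻¹ • truncation (m • z)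

lemma contDiff_scaledTruncation (m : ℝ) : ContDiff ℝ ∞ (scaledTruncation (k := k) m) :=
  (contDiff_truncation.comp (contDiff_const_smul m)).const_smul m⁻¹

lemma scaledTruncation_eq_zero {m : ℝ} (hm : 0 < m) {z : Ambient k} (hz : ‖z‖ ≤ m⁻¹) :
    scaledTruncation m z = 0 := by
  rw [scaledTruncation, truncation_eq_zero, smul_zero]
  rw [norm_smul, Real.norm_of_nonneg hm.le]
  calc m * ‖z‖ ≤ m * m⁻¹ := by gcongr
    _ = 1 := mul_inv_cancel₀ hm.ne'

lemma scaledTruncation_eq_self {m : ℝ} (hm : 0 < m) {z : Ambient k} (hz : 2 ≤ m * ‖z‖) :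
    scaledTruncation m z = z := by
  rw [scaledTruncation, truncation_eq_self, smul_smul, inv_mul_cancel₀ hm.ne', one_smul]
  rwa [norm_smul, Real.norm_of_nonneg hm.le]

lemma norm_scaledTruncation_le {m : ℝ} (hm : 0 < m) (z : Ambient k) :
    ‖scaledTruncation m z‖ ≤ ‖z‖ := by
  rw [scaledTruncation, norm_smul, norm_inv, Real.norm_of_nonneg hm.le]
  calc m⁻¹ * ‖truncation (m • z)‖ ≤ m⁻¹ * ‖m • z‖ := by gcongr; exact norm_truncation_le _
    _ = ‖z‖ := by
      rw [norm_smul, Real.norm_of_nonneg hm.le, ← mul_assoc, inv_mul_cancel₀ hm.ne', one_mul]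

lemma inner_scaledTruncation (m : ℝ) {u z : Ambient k} (h : ⟪u, z⟫ = 0) :
    ⟪u, scaledTruncation m z⟫ = 0 := by
  simp [scaledTruncation, truncation, real_inner_smul_right, h]

/-- The factors m and m⁻¹ cancel, so a bound on the derivative of `truncation` is uniform in m. -/
lemma fderiv_scaledTruncation {m : ℝ} (hm : 0 < m) (z : Ambient k) :
    fderiv ℝ (scaledTruncation (k := k) m) z = fderiv ℝ truncation (m • z) := by
  have hd : DifferentiableAt ℝ (fun z : Ambient k => truncation (m • z)) z :=
    (contDiff_truncation.comp (contDiff_const_smul m)).differentiable (by simp) z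
  have h : scaledTruncation (k := k) m = fun z => m⁻¹ • truncation (m • z) := rfl
  rw [h, fderiv_fun_const_smul hd, fderiv_comp_smul, smul_smul, inv_mul_cancel₀ hm.ne', one_smul]

end Cutoff

/-! ### Gluing v to the Hopf flow -/

section Gluing

/-- The field that interpolates between `v` on `K` and `H` off `K`, equal to `H` near the points of
`K` where `v - H` is small. -/
def gluedField (K : Set (Sph k)) (v H : Sph k → Ambient k) (m : ℝ) (x : Sph k) : Ambient k :=
  H x + scaledTruncation m (K.indicator (fun x => v x - H x) x)

variable {K : Set (Sph k)} {v H : Sph k → Ambient k} {m : ℝ}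

lemma gluedField_eventuallyEq_of_mem_interior {x : Sph k} (hx : x ∈ interior K) :
    gluedField K v H m =ᶠ[𝓝 x] fun z => H z + scaledTruncation m (v z - H z) := by
  filter_upwards [mem_interior_iff_mem_nhds.1 hx] with z hz
  rw [gluedField, Set.indicator_of_mem hz]

/-- Near a point off K the indicator vanishes; near a point of K where v = H, continuity keeps ‖v −
H‖ below the truncation radius 1/m. -/
lemma gluedField_eventuallyEq_of_agree (hm : 0 < m) (hK : IsClosed K) {x : Sph k}
    (hvx : x ∈ K → v x = H x ∧ ContinuousAt (fun x => v x - H x) x) :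
    gluedField K v H m =ᶠ[𝓝 x] H := by
  by_cases hxK : x ∈ K
  · obtain ⟨h0, hc⟩ := hvx hxK
    have hsmall : ∀ᶠ z in 𝓝 x, ‖v z - H z‖ < m⁻¹ := by
      refine hc.norm.eventually_lt_const ?_
      simpa [h0] using hm
    filter_upwards [hsmall] with z hz
    rw [gluedField, scaledTruncation_eq_zero hm, add_zero]
    exact (norm_indicator_le_norm_self _ _).trans hz.le
  · filter_upwards [hK.isOpen_compl.mem_nhds hxK] with z hz
    rw [gluedField, Set.indicator_of_notMem hz, scaledTruncation_eq_zero hm (by simpa using hm.le),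
      add_zero]

lemma radialExt_glued_eventuallyEq {y : Ambient k} (hy : y ≠ 0) :
    radialExt (fun z => H z + scaledTruncation m (v z - H z)) =ᶠ[𝓝 y]
      fun z => radialExt H z + scaledTruncation m (radialExt v z - radialExt H z) := by
  filter_upwards [isOpen_compl_singleton.mem_nhds hy] with z hz
  simp only [radialExt_of_ne_zero _ hz]

lemma contDiffAt_radialExt_gluedField (hm : 0 < m) (hK : IsClosed K)
    (hv : ∀ y, y ≠ 0 → direction y ∈ K → ContDiffAt ℝ ∞ (radialExt v) y)
    (hH : ∀ y, y ≠ 0 → ContDiffAt ℝ ∞ (radialExt H) y)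
    (hb : ∀ x ∈ K, x ∉ interior K → v x = H x ∧ ContinuousAt (fun x => v x - H x) x)
    {y : Ambient k} (hy : y ≠ 0) : ContDiffAt ℝ ∞ (radialExt (gluedField K v H m)) y := by
  by_cases hx : direction y ∈ interior K
  · have hvy := hv y hy (interior_subset hx)
    have h : ContDiffAt ℝ ∞
        (fun z => radialExt H z + scaledTruncation m (radialExt v z - radialExt H z)) y :=
      (hH y hy).add ((contDiff_scaledTruncation m).contDiffAt.comp y (hvy.sub (hH y hy)))
    exact h.congr_of_eventuallyEq ((radialExt_congr hy
      (gluedField_eventuallyEq_of_mem_interior hx)).trans (radialExt_glued_eventuallyEq hy))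
  · exact (hH y hy).congr_of_eventuallyEq (radialExt_congr hy
      (gluedField_eventuallyEq_of_agree hm hK fun h => hb _ h hx))

lemma extDeriv_congr {v w : Sph k → Ambient k} {x : Sph k} (h : v =ᶠ[𝓝 x] w) :
    extDeriv v x = extDeriv w x :=
  (radialExt_congr x.ne_zero (by rwa [direction_coe])).fderiv_eq

lemma extDeriv_gluedField_of_mem (hm : 0 < m) (hK : IsClosed K)
    (hv : ∀ y, y ≠ 0 → direction y ∈ K → ContDiffAt ℝ ∞ (radialExt v) y)
    (hH : ∀ y, y ≠ 0 → ContDiffAt ℝ ∞ (radialExt H) y)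
    (hb : ∀ x ∈ K, x ∉ interior K → v x = H x ∧ ContinuousAt (fun x => v x - H x) x)
    {x : Sph k} (hx : x ∈ K) :
    extDeriv (gluedField K v H m) x = extDeriv H x +
      (fderiv ℝ truncation (m • (v x - H x))).comp (extDeriv v x - extDeriv H x) := by
  by_cases hxi : x ∈ interior K
  · rw [extDeriv_congr (gluedField_eventuallyEq_of_mem_interior hxi), extDeriv,
      (radialExt_glued_eventuallyEq x.ne_zero).fderiv_eq]
    have hHd : HasFDerivAt (radialExt H) (extDeriv H x) (x : Ambient k) :=
      ((hH x x.ne_zero).differentiableAt (by simp)).hasFDerivAt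
    have hvd : HasFDerivAt (radialExt v) (extDeriv v x) (x : Ambient k) :=
      ((hv x x.ne_zero (by rwa [direction_coe])).differentiableAt (by simp)).hasFDerivAt
    have ht := (((contDiff_scaledTruncation (k := k) m).differentiable (by simp))
      (radialExt v x - radialExt H x)).hasFDerivAt
    have h := hHd.add (ht.comp (x : Ambient k) (hvd.sub hHd))
    rw [fderiv_scaledTruncation hm, radialExt_coe, radialExt_coe] at h
    exact h.fderiv
  -- At a boundary point the formula persists because the derivative of `truncation` at v x − H x =
  -- 0 is zero.
  · rw [extDeriv_congr (gluedField_eventuallyEq_of_agree hm hK fun h => hb _ h hxi),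
      (hb x hx hxi).1]
    simp [fderiv_truncation_zero]

lemma extDeriv_gluedField_of_notMem (hm : 0 < m) (hK : IsClosed K) {x : Sph k} (hx : x ∉ K) :
    extDeriv (gluedField K v H m) x = extDeriv H x :=
  extDeriv_congr (gluedField_eventuallyEq_of_agree hm hK fun h => absurd h hx)

end Gluing

/-! ### The Bochner formula on K and the energy bound -/

/-- The integrated Bochner formula on a closed set `K`, for unit fields that agree with a Hopf flow
on the topological boundary of `K`. -/
theorem setIntegral_traceForm_extDeriv {U K : Set (Sph k)} (hU : IsOpen U) (hKU : K ⊆ U)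
    (hK : IsClosed K) {v H : Sph k → Ambient k} (hv : IsUnitVectorFieldOn U v) (hH : IsHopfFlow H)
    (hvH : ∀ x ∈ K, x ∉ interior K → v x = H x) :
    ∫ x in K, traceForm (extDeriv v x) ∂(sphVol k) = 2 * k * vol K := by
  obtain ⟨J, hJ, hHJ⟩ := hH
  have hKc : IsCompact K := hK.isCompact
  have hvs : ∀ y, y ≠ 0 → direction y ∈ K → ContDiffAt ℝ ∞ (radialExt v) y := fun y hy hyK =>
    contDiffAt_radialExt hy (hv.smooth.contMDiffAt (hU.mem_nhds (hKU hyK)))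
  have hHs : ∀ y, y ≠ 0 → ContDiffAt ℝ ∞ (radialExt H) y := fun y hy =>
    contDiffAt_radialExt_hopf hHJ hy
  have hHc : Continuous H := continuous_of_contDiffAt_radialExt hHs
  have hvc : ∀ x ∈ K, ContinuousAt v x := fun x hx =>
    (hv.smooth.contMDiffAt (hU.mem_nhds (hKU hx))).continuousAt
  have hb : ∀ x ∈ K, x ∉ interior K → v x = H x ∧ ContinuousAt (fun x => v x - H x) x :=
    fun x hx hxi => ⟨hvH x hx hxi, (hvc x hx).sub hHc.continuousAt⟩
  have hHn : ∀ x, ‖H x‖ = 1 := fun x => by rw [hHJ]; simp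
  have hvn : ∀ x ∈ K, ‖v x‖ = 1 := fun x hx => hv.unit x (hKU hx)
  have hHt : ∀ x : Sph k, ⟪(x : Ambient k), H x⟫ = 0 := fun x => by
    rw [hHJ]; exact mem_tan_iff.1 (hopf_mem_tan hJ x)
  have hm : ∀ n : ℕ, (0 : ℝ) < n + 1 := fun n => by positivity
  let V : ℕ → Sph k → Ambient k := fun n => gluedField K v H (n + 1)
  have hVs : ∀ n y, y ≠ 0 → ContDiffAt ℝ ∞ (radialExt (V n)) y := fun n y hy =>
    contDiffAt_radialExt_gluedField (hm n) hK hvs hHs hb hy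
  have hVt : ∀ n (x : Sph k), ⟪(x : Ambient k), V n x⟫ = 0 := by
    intro n x
    simp only [V, gluedField, inner_add_right, hHt, zero_add]
    refine inner_scaledTruncation _ ?_
    by_cases hx : x ∈ K
    · rw [Set.indicator_of_mem hx, inner_sub_right, hHt, mem_tan_iff.1 (hv.tangent x (hKU hx)),
        sub_zero]
    · rw [Set.indicator_of_notMem hx, inner_zero_right]
  have hVc : ∀ n, Continuous (V n) := fun n => continuous_of_contDiffAt_radialExt (hVs n)
  have hVDc : ∀ n, Continuous fun x => traceForm (extDeriv (V n) x) := fun n =>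
    continuous_traceForm.comp (continuous_iff_continuousAt.2 fun x =>
      continuousAt_extDeriv (hVs n x x.ne_zero))
  have hint : ∀ f : Sph k → ℝ, Continuous f → Integrable f (sphVol k) := fun f hf =>
    hf.integrable_of_hasCompactSupport (HasCompactSupport.of_compactSpace f)
  let f : ℕ → Sph k → ℝ := fun n x => traceForm (extDeriv (V n) x) - 2 * k * ‖V n x‖ ^ 2
  have hfc : ∀ n, Continuous (f n) := fun n =>
    (hVDc n).sub (continuous_const.mul ((hVc n).norm.pow 2))
  have hf0 : ∀ n, ∫ x, f n x ∂(sphVol k) = 0 := by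
    intro n
    have h := integral_traceForm_extDeriv (hVs n) (hVt n)
    simp only [f]
    rw [integral_sub (hint _ (hVDc n)) (hint (fun x => 2 * k * ‖V n x‖ ^ 2)
      (continuous_const.mul ((hVc n).norm.pow 2))), integral_const_mul, h, sub_self]
  have hDv : ContinuousOn (extDeriv v) K := fun x hx =>
    (continuousAt_extDeriv (hvs x x.ne_zero (by rwa [direction_coe]))).continuousWithinAt
  have hDH : Continuous (extDeriv H) := continuous_iff_continuousAt.2 fun x =>
    continuousAt_extDeriv (hHs x x.ne_zero)
  -- A Hopf flow satisfies the Bochner identity pointwise, so the complement of K contributes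
  -- nothing.
  have hfoff : ∀ n x, x ∉ K → f n x = 0 := by
    intro n x hx
    have hVx : V n x = H x := by
      simp only [V, gluedField]
      rw [Set.indicator_of_notMem hx, scaledTruncation_eq_zero (hm n) (by simpa using (hm n).le),
        add_zero]
    simp only [f]
    rw [hVx, hHn, show extDeriv (V n) x = extDeriv H x from
      extDeriv_gluedField_of_notMem (hm n) hK hx, traceForm_extDeriv_hopf hJ hHJ]
    ring
  have hDV : ∀ n, ∀ x ∈ K, extDeriv (V n) x = extDeriv H x +
      (fderiv ℝ truncation (((n : ℝ) + 1) • (v x - H x))).comp (extDeriv v x - extDeriv H x) :=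
    fun n x hx => extDeriv_gluedField_of_mem (hm n) hK hvs hHs hb hx
  have hVK : ∀ n, ∀ x ∈ K, V n x = H x + scaledTruncation ((n : ℝ) + 1) (v x - H x) := by
    intro n x hx
    simp only [V, gluedField]
    rw [Set.indicator_of_mem hx]
  -- On K all the derivatives of `V n` lie in one compact ball, on which `traceForm` is bounded.
  obtain ⟨M, hM⟩ : ∃ M, ∀ n x, ‖f n x‖ ≤ M := by
    obtain ⟨C, hC⟩ := exists_norm_fderiv_truncation_le (k := k)
    obtain ⟨C₁, hC₁⟩ := hKc.exists_bound_of_continuousOn hDH.continuousOn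
    obtain ⟨C₂, hC₂⟩ := hKc.exists_bound_of_continuousOn (hDv.sub hDH.continuousOn)
    obtain ⟨Q, hQ⟩ := (isCompact_closedBall (0 : Ambient k →L[ℝ] Ambient k)
      (C₁ + C * C₂)).exists_bound_of_continuousOn continuous_traceForm.continuousOn
    refine ⟨max (Q + 2 * k * 3 ^ 2) 0, fun n x => ?_⟩
    by_cases hx : x ∈ K
    · refine le_trans ?_ (le_max_left _ _)
      have h1 : ‖traceForm (extDeriv (V n) x)‖ ≤ Q := by
        refine hQ _ ?_
        rw [mem_closedBall_zero_iff, hDV n x hx]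
        refine (norm_add_le _ _).trans (add_le_add (hC₁ x hx) ?_)
        refine (ContinuousLinearMap.opNorm_comp_le _ _).trans ?_
        exact mul_le_mul (hC _) (hC₂ x hx) (norm_nonneg _) ((norm_nonneg _).trans (hC 0))
      have h2 : ‖V n x‖ ≤ 3 := by
        rw [hVK n x hx]
        calc _ ≤ ‖H x‖ + ‖v x - H x‖ :=
              (norm_add_le _ _).trans (by gcongr; exact norm_scaledTruncation_le (hm n) _)
          _ ≤ ‖H x‖ + (‖v x‖ + ‖H x‖) := by gcongr; exact norm_sub_le _ _
          _ = 3 := by rw [hHn, hvn x hx]; norm_num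
      have h3 : ‖2 * (k : ℝ) * ‖V n x‖ ^ 2‖ ≤ 2 * k * 3 ^ 2 := by
        rw [Real.norm_of_nonneg (by positivity)]
        gcongr
      exact (norm_sub_le _ _).trans (add_le_add h1 h3)
    · rw [hfoff n x hx, norm_zero]
      exact le_max_right _ _
  let g : Sph k → ℝ := K.indicator fun x => traceForm (extDeriv v x) - 2 * k
  have hZ : IsClosed (K ∩ (fun x => v x - H x) ⁻¹' {0}) :=
    ContinuousOn.preimage_isClosed_of_isClosed
      (fun x hx => ((hvc x hx).sub hHc.continuousAt).continuousWithinAt) hK isClosed_singleton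
  have hsubext : radialExt (fun x => v x - H x) = fun y => radialExt v y - radialExt H y := by
    funext y
    by_cases hy : y = 0
    · simp [radialExt, hy]
    · simp only [radialExt_of_ne_zero _ hy]
  have hzero : ∀ᵐ x ∂(sphVol k), x ∈ K → v x = H x → extDeriv v x = extDeriv H x := by
    have h := ae_extDeriv_eq_zero (g := fun x => v x - H x) hZ (fun x hx => hx.2)
      (fun y hy hyZ => by rw [hsubext]; exact (hvs y hy hyZ.1).sub (hHs y hy))
    filter_upwards [h] with x hx hxK hxv
    have h0 := hx ⟨hxK, by simp [hxv]⟩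
    rw [extDeriv, hsubext, fderiv_fun_sub
      ((hvs x x.ne_zero (by rwa [direction_coe])).differentiableAt (by simp))
      ((hHs x x.ne_zero).differentiableAt (by simp))] at h0
    exact sub_eq_zero.1 h0
  have hlim : ∀ᵐ x ∂(sphVol k), Tendsto (fun n => f n x) atTop (𝓝 (g x)) := by
    filter_upwards [hzero] with x hx
    by_cases hxK : x ∈ K
    · simp only [g, Set.indicator_of_mem hxK]
      -- The sequence is eventually constant. Where v = H, each `V n` has the value and derivative
      -- of H, hence those of v outside a null set. Elsewhere the truncation is the identity near v
      -- x − H x once (n + 1)‖v x − H x‖ > 2.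
      refine tendsto_const_nhds.congr' ?_
      by_cases hvx : v x = H x
      · filter_upwards with n
        simp only [f]
        rw [hDV n x hxK, hVK n x hxK, hvx, hx hxK hvx, sub_self, sub_self,
          ContinuousLinearMap.comp_zero, add_zero,
          scaledTruncation_eq_zero (hm n) (by simpa using (hm n).le), add_zero, hHn]
        ring
      · have hpos : 0 < ‖v x - H x‖ := norm_pos_iff.2 (sub_ne_zero.2 hvx)
        have htop : Tendsto (fun n : ℕ => ((n : ℝ) + 1) * ‖v x - H x‖) atTop atTop :=
          (tendsto_atTop_add_const_right _ 1 tendsto_natCast_atTop_atTop).atTop_mul_const hpos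
        filter_upwards [htop.eventually_gt_atTop 2] with n hn
        simp only [f]
        rw [hDV n x hxK, hVK n x hxK, scaledTruncation_eq_self (hm n) hn.le,
          fderiv_truncation_of_lt (by rwa [norm_smul, Real.norm_of_nonneg (hm n).le]),
          ContinuousLinearMap.id_comp, add_sub_cancel, add_sub_cancel, hvn x hxK]
        ring
    · simp only [g, Set.indicator_of_notMem hxK]
      exact tendsto_const_nhds.congr fun n => (hfoff n x hxK).symm
  have hdom := tendsto_integral_of_dominated_convergence (fun _ => M)
    (fun n => (hfc n).aestronglyMeasurable) (integrable_const M)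
    (fun n => Eventually.of_forall (hM n)) hlim
  simp only [hf0] at hdom
  have hg : ∫ x, g x ∂(sphVol k) = 0 := tendsto_nhds_unique hdom tendsto_const_nhds
  have hvint : IntegrableOn (fun x => traceForm (extDeriv v x)) K (sphVol k) :=
    (continuous_traceForm.comp_continuousOn hDv).integrableOn_compact hKc
  rw [integral_indicator hK.measurableSet, integral_sub hvint (integrable_const _),
    setIntegral_const] at hg
  rw [vol]
  simp only [smul_eq_mul] at hg
  linarith

lemma integrableOn_normSqCovDeriv {K : Set (Sph k)} (hK : IsCompact K) {v : Sph k → Ambient k}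
    (hv : ContinuousOn (extDeriv v) K) : IntegrableOn (normSqCovDeriv v) K (sphVol k) := by
  refine ContinuousOn.integrableOn_compact hK ?_
  rw [show normSqCovDeriv v = _ from funext (normSqCovDeriv_eq v)]
  refine continuousOn_finsetSum _ fun i _ => ?_
  have h1 : ContinuousOn (fun x => extDeriv v x (EuclideanSpace.single i 1)) K :=
    hv.clm_apply continuousOn_const
  exact (h1.norm.pow 2).sub ((continuous_subtype_val.continuousOn.inner h1).pow 2)

/-- In an adapted chart, a positive zeroth coordinate is an open condition that implies membership
in K. -/
lemma mem_bdry_of_notMem_interior {K : Set (Sph k)} (hK : IsSubmanifoldWithBoundary K) {x : Sph k}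
    (hx : x ∈ K) (hxi : x ∉ interior K) : x ∈ bdry K := by
  obtain ⟨e, he, hxe⟩ := hK x hx
  refine ⟨e, he, hxe, ?_⟩
  by_contra hne
  have hpos : 0 < e x 0 := lt_of_le_of_ne ((he.2 x hxe).1 hx) (Ne.symm hne)
  apply hxi
  rw [mem_interior_iff_mem_nhds]
  have hc : ContinuousAt (fun z => e z 0) x :=
    (EuclideanSpace.proj (0 : Fin (2 * k + 1)) :
      EuclideanSpace ℝ (Fin (2 * k + 1)) →L[ℝ] ℝ).continuous.continuousAt.comp (e.continuousAt hxe)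
  filter_upwards [e.open_source.mem_nhds hxe, hc.eventually_const_lt hpos] with z hz hz0
  exact (he.2 z hz).2 hz0.le

lemma energy_hopf {K : Set (Sph k)} (hK : MeasurableSet K) {H : Sph k → Ambient k}
    (hH : IsHopfFlow H) : energy K H = ((2 * (k : ℝ) + 1) / 2 + k) * vol K := by
  obtain ⟨J, hJ, hHJ⟩ := hH
  rw [energy, setIntegral_congr_fun hK (fun x _ => normSqCovDeriv_hopf hJ hHJ x),
    setIntegral_const, vol, smul_eq_mul]
  ring

end HopfEnergy

end

open HopfEnergy in
theorem theorem1p6 (k : ℕ) (U K : Set (Sph k)) (hU : IsOpen U) (hKU : K ⊆ U)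
    (hK : IsSubmanifoldWithBoundary K) (hKcompact : IsCompact K) (hKconn : IsConnected K)
    (v H : Sph k → Ambient k) (hv : IsUnitVectorFieldOn U v) (hsol : IsSolenoidalOn U v)
    (hH : IsHopfFlow H) (hvH : ∀ x ∈ bdry K, v x = H x) :
    ((2 * (k : ℝ) + 1) / 2 + k) * vol K ≤ energy K v ∧
      ((2 * (k : ℝ) + 1) / 2 + k) * vol K = energy K H := by
  refine ⟨?_, (energy_hopf hKcompact.measurableSet hH).symm⟩
  have hD : ContinuousOn (extDeriv v) K := fun x hx =>
    (continuousAt_extDeriv (contDiffAt_radialExt x.ne_zero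
      (hv.smooth.contMDiffAt (hU.mem_nhds (by rw [direction_coe]; exact hKU hx))))).continuousWithinAt
  have hle : ∫ x in K, traceForm (extDeriv v x) ∂(sphVol k) ≤
      ∫ x in K, normSqCovDeriv v x ∂(sphVol k) :=
    MeasureTheory.setIntegral_mono_on
      ((continuous_traceForm.comp_continuousOn hD).integrableOn_compact hKcompact)
      (integrableOn_normSqCovDeriv hKcompact hD) hKcompact.measurableSet
      fun x hx => traceForm_extDeriv_le (hsol x (hKU hx))
  rw [setIntegral_traceForm_extDeriv hU hKU hKcompact.isClosed hv hH
    fun x hx hxi => hvH x (mem_bdry_of_notMem_interior hK hx hxi)] at hle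
  rw [energy]
  linarith
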